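/- Let $N\ge 1$ servers each store the same $K$ messages $X_1,\dots,X_K$, which are independent and uniformly distributed over $\mathbb F_{2^t}$ (so each is $t\ge 1$ bits long). Let $0\le M<K$ with $(M+1)\mid K$. A user wants $X_W$ and knows $X_S=(X_i)_{i\in S}$, where the demand index $\mathbf W\in[K]$ and the side information index set $\mathbf S\subset[K]$ are independent of the messages and have the joint distribution $$p_{\mathbf W,\mathbf S}(W,S)=\frac{1}{(K-M)\binom KM}\ \text{ if } W\notin S,\ |S|=M,\qquad p_{\mathbf W,\mathbf S}(W,S)=0\ \text{ otherwise.}$$ A (single-round) $W$-PIR-SI scheme consists of a message length $t\ge1$, finite query and answer alphabets, for each $(W,S)$ random queries $Q_1^{[W,S]},\dots,Q_N^{[W,S]}$, drawn jointly as a stochastic function of $W$, $S$ and $X_S$ only, and answers $A_j^{[W,S]}$ that are, for each server $j$, a deterministic function of $Q_j^{[W,S]}$ and $X_1,\dots,X_K$, such that - (decodability) $H\big(X_W\mid A_1^{[W,S]},\dots,A_N^{[W,S]},X_S\big)=0$ for all $W\in[K]$ and $S\subseteq[K]\setminus\{W\}$ with $|S|=M$; - ($W$-privacy against non-colluding servers)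 $I\big(\mathbf W;\,Q_j^{[\mathbf W,\mathbf S]},A_j^{[\mathbf W,\mathbf S]},X_1,\dots,X_K\big)=0$ for every $j\in[N]$. Its rate is $R=t\big/\sum_{j=1}^N H\big(A_j^{[W,S]}\big)$, entropies being in bits (the minimum over the admissible pairs $(W,S)$, if this depends on the pair). The capacity $C_W$ is the supremum of the rates of all $W$-PIR-SI schemes for the given $N,K,M$, over all $t$. Then $$C_W\;\ge\;\left(1+\frac1N+\cdots+\frac1{N^{\frac{K}{M+1}-1}}\right)^{-1}.$$ -/

import Mathlib

open scoped BigOperators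

noncomputable section

namespace PIRSI

section Information

variable {Ω α β : Type} [Fintype α] [Fintype β]

/-- The probability that the random variable `Y` on the probability space `(Ω, μ)` equals `a`. -/
def prob (μ : PMF Ω) (Y : Ω → α) (a : α) : ℝ := (μ.map Y a).toReal

/-- Shannon entropy in bits, `H(Y) = -∑ P(Y = a) log₂ P(Y = a)`. -/
def entropy (μ : PMF Ω) (Y : Ω → α) : ℝ :=
  (∑ a, Real.negMulLog (prob μ Y a)) / Real.log 2

/-- Conditional entropy in bits, `H(Y | Z) = ∑ P(Y = a, Z = b) log₂ (P(Z = b) / P(Y = a, Z = b))`;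
terms with `P(Y = a, Z = b) = 0` vanish. -/
def condEntropy (μ : PMF Ω) (Y : Ω → α) (Z : Ω → β) : ℝ :=
  ∑ a, ∑ b, prob μ (fun ω => (Y ω, Z ω)) (a, b) *
    Real.logb 2 (prob μ Z b / prob μ (fun ω => (Y ω, Z ω)) (a, b))

/-- Mutual information in bits,
`I(Y ; Z) = ∑ P(Y = a, Z = b) log₂ (P(Y = a, Z = b) / (P(Y = a) P(Z = b)))`;
terms with `P(Y = a, Z = b) = 0` vanish. -/
def mutualInfo (μ : PMF Ω) (Y : Ω → α) (Z : Ω → β) : ℝ :=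
  ∑ a, ∑ b, prob μ (fun ω => (Y ω, Z ω)) (a, b) *
    Real.logb 2 (prob μ (fun ω => (Y ω, Z ω)) (a, b) / (prob μ Y a * prob μ Z b))

end Information

/-- Messages of `t` bits: binary vectors, i.e. the elements of `GF(2^t)` in an `𝔽₂`-basis. -/
abbrev Message (t : ℕ) : Type := Fin t → ZMod 2

/-- The contents of the database: `K` messages of `t` bits. -/
abbrev Database (K t : ℕ) : Type := Fin K → Message t

/-- A single-round scheme for `N` servers storing the same `K` messages of `t ≥ 1` bits.
The (possibly stochastic) queries depend on the demand `W`, the side information index set `S` and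
the side information `X_S` only; the queries to the `N` servers may be drawn jointly. The answer of
server `j` is a function of the query that `j` receives and of the messages. -/
structure Scheme (N K : ℕ) where
  /-- message length in bits -/
  t : ℕ
  t_pos : 0 < t
  /-- query alphabet -/
  Query : Type
  [fintypeQuery : Fintype Query]
  /-- answer alphabet -/
  Answer : Type
  [fintypeAnswer : Fintype Answer]
  /-- the joint law of the `N` queries, given `W`, `S` and `X_S` -/
  query : (W : Fin K) → (S : Finset (Fin K)) → (S → Message t) → PMF (Fin N → Query)
  /-- the answer of a server to a query -/
  answer : Fin N → Query → Database K t → Answer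

attribute [instance] Scheme.fintypeQuery Scheme.fintypeAnswer

namespace Scheme

variable {N K : ℕ}

/-- The joint law of the messages (independent and uniform) and the `N` queries, for a given
demand index `W` and side information index set `S`. -/
def law (σ : Scheme N K) (W : Fin K) (S : Finset (Fin K)) :
    PMF (Database K σ.t × (Fin N → σ.Query)) :=
  (PMF.uniformOfFintype (Database K σ.t)).bind fun X =>
    (σ.query W S fun i => X i).map fun Q => (X, Q)

/-- The joint law of the demand index, the side information index set, the messages and the
queries, when `(W, S)` has law `p`. The messages are independent of `(W, S)`. -/
def jointLaw (σ : Scheme N K) (p : PMF (Fin K × Finset (Fin K))) :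
    PMF ((Fin K × Finset (Fin K)) × (Database K σ.t × (Fin N → σ.Query))) :=
  p.bind fun ws => (σ.law ws.1 ws.2).map fun ω => (ws, ω)

/-- The answer `A_j` of server `j`, as a random variable. -/
def answerVar (σ : Scheme N K) (j : Fin N) (ω : Database K σ.t × (Fin N → σ.Query)) :
    σ.Answer :=
  σ.answer j (ω.2 j) ω.1

/-- Decodability: `H(X_W | A_1, …, A_N, X_S) = 0` for every demand index `W` and every side
information index set `S` of size `M` that does not contain `W`. -/
def Decodable (σ : Scheme N K) (M : ℕ) : Prop :=
  ∀ (W : Fin K) (S : Finset (Fin K)), W ∉ S → S.card = M →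
    condEntropy (σ.law W S) (fun ω => ω.1 W)
      (fun ω => ((fun j : Fin N => σ.answerVar j ω), (fun i : S => ω.1 i))) = 0

/-- `W`-privacy: `I(W ; Q_j, A_j, X_1, …, X_K) = 0` for every server `j`, when the pair of demand
index and side information index set has law `p`. -/
def WPrivate (σ : Scheme N K) (p : PMF (Fin K × Finset (Fin K))) : Prop :=
  ∀ j : Fin N,
    mutualInfo (σ.jointLaw p) (fun ω => ω.1.1)
      (fun ω => (ω.2.2 j, σ.answerVar j ω.2, ω.2.1)) = 0

/-- The ratio `t / ∑_j H(A_j)` for a given demand index `W` and side information index set `S`. -/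
def rateAt (σ : Scheme N K) (W : Fin K) (S : Finset (Fin K)) : ℝ :=
  (σ.t : ℝ) / ∑ j : Fin N, entropy (σ.law W S) (σ.answerVar j)

/-- The rate of a scheme for side information of size `M`: the ratio `t / ∑_j H(A_j)`, at the
worst pair `(W, S)` if it depends on the pair. -/
def rate (σ : Scheme N K) (M : ℕ) : EReal :=
  ⨅ (W : Fin K) (S : Finset (Fin K)) (_ : W ∉ S ∧ S.card = M), (σ.rateAt W S : EReal)

end Scheme

/-- The `W`-privacy capacity: the supremum of the rates of all decodable `W`-private schemes, over
all message lengths and all finite query and answer alphabets. -/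
def capacityW (N K M : ℕ) (p : PMF (Fin K × Finset (Fin K))) : EReal :=
  ⨆ (σ : Scheme N K) (_ : σ.Decodable M ∧ σ.WPrivate p), σ.rate M

lemma sum_uniformLaw (K M : ℕ) (h : M < K) :
    ∑ a : Fin K × Finset (Fin K),
      (if a.1 ∉ a.2 ∧ a.2.card = M then
        (((K - M) * K.choose M : ℕ) : ENNReal)⁻¹ else 0) = 1 := by
  have hcard : (Finset.univ.filter fun a : Fin K × Finset (Fin K) =>
      a.1 ∉ a.2 ∧ a.2.card = M).card = (K - M) * K.choose M := by
    rw [Finset.card_filter, ← Finset.univ_product_univ, Finset.sum_product_right]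
    have : ∀ S : Finset (Fin K), (∑ W : Fin K, if W ∉ S ∧ S.card = M then 1 else 0)
        = if S.card = M then K - M else 0 := by
      intro S
      by_cases hS : S.card = M
      · simp only [hS, and_true, if_true]
        rw [← Finset.card_filter, ← hS]
        have : (Finset.univ.filter fun W : Fin K => W ∉ S) = Sᶜ := by ext; simp
        rw [this, Finset.card_compl, Fintype.card_fin]
      · simp [hS]
    rw [Finset.sum_congr rfl fun S _ => this S, ← Finset.sum_filter, Finset.sum_const]
    have : (Finset.univ.filter fun S : Finset (Fin K) => S.card = M)
        = Finset.powersetCard M Finset.univ := by ext; simp [Finset.mem_powersetCard]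
    rw [this, Finset.card_powersetCard, Finset.card_univ, Fintype.card_fin, smul_eq_mul, mul_comm]
  rw [← Finset.sum_filter, Finset.sum_const, hcard, nsmul_eq_mul]
  refine ENNReal.mul_inv_cancel ?_ (ENNReal.natCast_ne_top _)
  have := Nat.choose_pos h.le
  have h2 : 0 < K - M := Nat.sub_pos_of_lt h
  exact_mod_cast (Nat.mul_pos h2 this).ne'

/-- The joint law of the demand index and the side information index set: probability
`1 / ((K - M) * (K choose M))` for each `(W, S)` with `W ∉ S` and `|S| = M`, and `0` otherwise. -/
def uniformLaw (K M : ℕ) (h : M < K) : PMF (Fin K × Finset (Fin K)) :=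
  PMF.ofFintype
    (fun a => if a.1 ∉ a.2 ∧ a.2.card = M then
      (((K - M) * K.choose M : ℕ) : ENNReal)⁻¹ else 0)
    (sum_uniformLaw K M h)

end PIRSI

end

noncomputable section

namespace PIRSI

/-! ### Entropy and mutual information of finite random variables. -/

section Information

variable {Ω α β : Type}

/-! Put `g = K / (M + 1)`. A random partition of the indices into `g` classes of size `M + 1`, with
`{W} ∪ S` as one class, reduces the problem to private retrieval among `g` class sums: the sum over
the class of `W`, together with `X_S`, reveals `X_W`.

For `N ≥ 2` each message is cut into `N - 1` blocks of `L` bits, and a zero block is added at index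
`0`. Every class gets a uniform index in `ZMod N`; server `j` sees the index of the class of `W`
shifted by `j` and returns the sum of the selected blocks. Some server hits index `0` in that class,
so it returns the interference of the other classes alone; subtracting it and the side information
from the other answers yields all blocks of `X_W` (`payloadDecodable_symbolSum`). The payload is
empty when all indices vanish, which has probability `N ^ (-g)`, so about `N * L * (1 - N ^ (-g))`
bits are downloaded for `L * (N - 1)` bits of message.

Privacy (`colorScheme_wPrivate`) holds because, once `S` is averaged out, each server sees a uniform
partition and uniform indices whatever `W` is. Decoding may use only the answers and `X_S`, so each
answer repeats its query; this cost does not depend on `L` and vanishes as `L` grows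
(`le_capacityW_of_payload`). -/

lemma prob_nonneg (μ : PMF Ω) (Y : Ω → α) (a : α) : 0 ≤ prob μ Y a := ENNReal.toReal_nonneg

lemma prob_pos_iff {μ : PMF Ω} {Y : Ω → α} {a : α} :
    0 < prob μ Y a ↔ ∃ ω ∈ μ.support, Y ω = a := by
  rw [prob, ENNReal.toReal_pos_iff, and_iff_left ((PMF.apply_ne_top _ _).lt_top), pos_iff_ne_zero,
    ← PMF.mem_support_iff, PMF.mem_support_map_iff]

variable [Fintype α]

lemma pmf_map_apply_eq_sum (p : PMF α) (φ : α → β) [DecidableEq β] (b : β) :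
    p.map φ b = ∑ a, if φ a = b then p a else 0 := by
  classical
  rw [PMF.map_apply, tsum_fintype]
  refine Finset.sum_congr rfl fun a _ => ?_
  congr! 1
  exact eq_comm

variable [Fintype β]

lemma pmf_sum_eq_one (p : PMF α) : ∑ a, p a = 1 := by
  rw [← tsum_fintype (L := .unconditional _)]; exact p.tsum_coe

lemma sum_prob (μ : PMF Ω) (Y : Ω → α) : ∑ a, prob μ Y a = 1 := by
  unfold prob
  rw [← ENNReal.toReal_sum fun a _ => PMF.apply_ne_top _ _, pmf_sum_eq_one, ENNReal.toReal_one]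

/-- The expectation of a function of `φ ∘ Y`, computed from the law of `Y`. -/
lemma sum_prob_comp (μ : PMF Ω) (Y : Ω → α) (φ : α → β) (h : β → ℝ) :
    ∑ a, prob μ Y a * h (φ a) = ∑ b, prob μ (fun ω => φ (Y ω)) b * h b := by
  classical
  have key : ∀ b, prob μ (fun ω => φ (Y ω)) b = ∑ a, if φ a = b then prob μ Y a else 0 := by
    intro b
    have : μ.map (fun ω => φ (Y ω)) = (μ.map Y).map φ := by rw [PMF.map_comp]; rfl
    rw [prob, this, pmf_map_apply_eq_sum, ENNReal.toReal_sum]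
    · refine Finset.sum_congr rfl fun a _ => ?_
      split_ifs <;> simp [prob]
    · intro a _
      split_ifs
      · exact PMF.apply_ne_top _ _
      · simp
  simp_rw [key, Finset.sum_mul]
  rw [Finset.sum_comm]
  refine Finset.sum_congr rfl fun a _ => ?_
  simp [ite_mul]

/-- On an atom `(a, b)` of positive mass the events `Z = b` and `(Y, Z) = (a, b)` agree up to a null
set, so the logarithm is `log 1`. -/
lemma condEntropy_eq_zero_of_determined (μ : PMF Ω) (Y : Ω → α) (Z : Ω → β)
    (h : ∀ ω ∈ μ.support, ∀ ω' ∈ μ.support, Z ω = Z ω' → Y ω = Y ω') :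
    condEntropy μ Y Z = 0 := by
  classical
  refine Finset.sum_eq_zero fun a _ => Finset.sum_eq_zero fun b _ => ?_
  rcases (prob_nonneg μ (fun ω => (Y ω, Z ω)) (a, b)).eq_or_lt with h0 | h0
  · rw [← h0, zero_mul]
  obtain ⟨ω₀, hω₀, he⟩ := prob_pos_iff.1 h0
  obtain ⟨ha, hb⟩ := Prod.mk.inj he
  have : prob μ Z b = prob μ (fun ω => (Y ω, Z ω)) (a, b) := by
    unfold prob
    rw [PMF.map_apply, PMF.map_apply]
    congr 1
    refine tsum_congr fun ω => ?_
    by_cases hω : ω ∈ μ.support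
    · have : b = Z ω ↔ (a, b) = (Y ω, Z ω) :=
        ⟨fun hz => Prod.ext (ha ▸ h ω₀ hω₀ ω hω (hb.trans hz)) hz, fun hz => (Prod.mk.inj hz).2⟩
      congr! 1
    · rw [(PMF.apply_eq_zero_iff _ _).2 hω]; simp
  rw [this, div_self h0.ne', Real.logb_one, mul_zero]

/-- If the joint law of `(Y, Z)` does not depend on the value of `Y`, then `Y` is independent
of `Z`. -/
lemma mutualInfo_eq_zero_of_const (μ : PMF Ω) (Y : Ω → α) (Z : Ω → β)
    (h : ∀ a a' b, prob μ (fun ω => (Y ω, Z ω)) (a, b) = prob μ (fun ω => (Y ω, Z ω)) (a', b)) :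
    mutualInfo μ Y Z = 0 := by
  classical
  refine Finset.sum_eq_zero fun a _ => Finset.sum_eq_zero fun b _ => ?_
  set J := prob μ (fun ω => (Y ω, Z ω)) with hJ
  have hY : prob μ Y a = ∑ b, J (a, b) := by
    have := sum_prob_comp μ (fun ω => (Y ω, Z ω)) Prod.fst (fun y => if y = a then 1 else 0)
    simp only [mul_ite, mul_one, mul_zero, Finset.sum_ite_eq', Finset.mem_univ, if_true] at this
    rw [← this, Fintype.sum_prod_type, Finset.sum_comm]
    simp [hJ]
  have hZ : prob μ Z b = Fintype.card α * J (a, b) := by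
    have := sum_prob_comp μ (fun ω => (Y ω, Z ω)) Prod.snd (fun z => if z = b then 1 else 0)
    simp only [mul_ite, mul_one, mul_zero, Finset.sum_ite_eq', Finset.mem_univ, if_true] at this
    rw [← this, Fintype.sum_prod_type]
    simp only [Finset.sum_ite_eq', Finset.mem_univ, if_true]
    rw [Finset.sum_congr rfl fun a' _ => h a' a b]
    simp [hJ]
  have h1 : (Fintype.card α : ℝ) * prob μ Y a = 1 := by
    rw [hY, ← sum_prob μ (fun ω => (Y ω, Z ω)), Fintype.sum_prod_type,
      Finset.sum_congr rfl fun a' _ => Finset.sum_congr rfl fun b' _ => h a' a b']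
    simp [hJ]
  have : prob μ Y a * prob μ Z b = J (a, b) := by
    rw [hZ, ← mul_assoc, mul_comm (prob μ Y a), h1, one_mul]
  rw [this]
  by_cases h0 : J (a, b) = 0
  · rw [h0, zero_mul]
  · rw [div_self h0, Real.logb_one, mul_zero]

/-- The entropy is at most the expected length of any assignment of lengths to the possible values
that satisfies Kraft's inequality. -/
lemma entropy_le_of_kraft (μ : PMF Ω) (Y : Ω → α) (T : Finset α) (ℓ : α → ℝ)
    (hT : ∀ ω ∈ μ.support, Y ω ∈ T) (hℓ : ∑ a ∈ T, (2 : ℝ) ^ (-ℓ a) ≤ 1) :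
    entropy μ Y ≤ ∑ a, prob μ Y a * ℓ a := by
  classical
  have h2 : 0 < Real.log 2 := Real.log_pos one_lt_two
  have h0 : ∀ a ∉ T, prob μ Y a = 0 := fun a ha => by
    by_contra hne
    obtain ⟨ω, hω, rfl⟩ := prob_pos_iff.1 ((prob_nonneg μ Y a).lt_of_ne' hne)
    exact ha (hT ω hω)
  have hterm : ∀ a, Real.negMulLog (prob μ Y a) ≤
      prob μ Y a * ℓ a * Real.log 2 + ((if a ∈ T then (2 : ℝ) ^ (-ℓ a) else 0) - prob μ Y a) := by
    intro a
    by_cases ha : a ∈ T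
    · rw [if_pos ha]
      rcases (prob_nonneg μ Y a).eq_or_lt with hp | hp
      · rw [← hp]
        simp only [Real.negMulLog_zero, zero_mul, sub_zero, zero_add]
        positivity
      · have hb : (0 : ℝ) < 2 ^ (-ℓ a) := by positivity
        -- Gibbs' inequality, termwise: `log x ≤ x - 1` at `x = 2 ^ (-ℓ a) / P(Y = a)`.
        have := Real.log_le_sub_one_of_pos (div_pos hb hp)
        rw [Real.log_div hb.ne' hp.ne', Real.log_rpow two_pos] at this
        have h3 := mul_le_mul_of_nonneg_left this hp.le
        rw [mul_sub_one, mul_div_cancel₀ _ hp.ne'] at h3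
        rw [Real.negMulLog]
        linarith
    · rw [h0 a ha, if_neg ha]; simp
  rw [entropy, div_le_iff₀ h2, Finset.sum_mul]
  refine (Finset.sum_le_sum fun a _ => hterm a).trans ?_
  rw [Finset.sum_add_distrib, Finset.sum_sub_distrib, sum_prob, ← Finset.sum_filter,
    Finset.filter_mem_eq_inter, Finset.univ_inter]
  linarith

lemma prob_le_one (μ : PMF Ω) (Y : Ω → α) (a : α) : prob μ Y a ≤ 1 :=
  sum_prob μ Y ▸ Finset.single_le_sum (fun a _ => prob_nonneg μ Y a) (Finset.mem_univ a)

lemma entropy_nonneg (μ : PMF Ω) (Y : Ω → α) : 0 ≤ entropy μ Y :=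
  div_nonneg (Finset.sum_nonneg fun a _ =>
    Real.negMulLog_nonneg (prob_nonneg μ Y a) (prob_le_one μ Y a)) (Real.log_nonneg one_le_two)

lemma entropy_pos_of_ne (μ : PMF Ω) (Y : Ω → α) {ω ω' : Ω} (hω : ω ∈ μ.support)
    (hω' : ω' ∈ μ.support) (hne : Y ω ≠ Y ω') : 0 < entropy μ Y := by
  classical
  refine div_pos (Finset.sum_pos' (fun a _ =>
    Real.negMulLog_nonneg (prob_nonneg μ Y a) (prob_le_one μ Y a))
      ⟨Y ω, Finset.mem_univ _, ?_⟩) (Real.log_pos one_lt_two)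
  have h1 : 0 < prob μ Y (Y ω) := prob_pos_iff.2 ⟨ω, hω, rfl⟩
  have h2 : 0 < prob μ Y (Y ω') := prob_pos_iff.2 ⟨ω', hω', rfl⟩
  have h3 : prob μ Y (Y ω) + prob μ Y (Y ω') ≤ 1 := by
    rw [← sum_prob μ Y, ← Finset.sum_pair hne]
    exact Finset.sum_le_sum_of_subset_of_nonneg (Finset.subset_univ _)
      fun a _ _ => prob_nonneg μ Y a
  have h4 := Real.log_neg h1 (by linarith)
  rw [Real.negMulLog]
  nlinarith

end Information

/-! ### Counting partitions into labelled classes of equal size. -/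

section Colorings

variable {N K g m : ℕ}

/-- The set of the indices that have colour `l`. -/
def colorClass (c : Fin K → Fin g) (l : Fin g) : Finset (Fin K) :=
  Finset.univ.filter fun i => c i = l

/-- The partitions of `[K]` into `g` labelled classes of size `m`, one of which is `T`. -/
def colorings (g m : ℕ) (T : Finset (Fin K)) : Finset (Fin K → Fin g) :=
  Finset.univ.filter fun c => (∀ l, (colorClass c l).card = m) ∧ ∃ l, colorClass c l = T

lemma mem_colorClass {c : Fin K → Fin g} {l : Fin g} {i : Fin K} :
    i ∈ colorClass c l ↔ c i = l := by
  simp [colorClass]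

lemma mem_colorings {T : Finset (Fin K)} {c : Fin K → Fin g} :
    c ∈ colorings g m T ↔ (∀ l, (colorClass c l).card = m) ∧ ∃ l, colorClass c l = T := by
  simp [colorings]

lemma colorClass_of_mem_colorings {T : Finset (Fin K)} {c : Fin K → Fin g}
    (hc : c ∈ colorings g m T) {W : Fin K} (hW : W ∈ T) : colorClass c (c W) = T := by
  obtain ⟨-, l, rfl⟩ := mem_colorings.1 hc
  rw [mem_colorClass.1 hW]

lemma colorClass_comp (c : Fin K → Fin g) (π : Equiv.Perm (Fin K)) (l : Fin g) :
    colorClass (c ∘ π) l = (colorClass c l).map π.symm.toEmbedding := by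
  ext i
  simp [mem_colorClass]

lemma exists_perm_map_eq {T T' : Finset (Fin K)} (h : T.card = T'.card) :
    ∃ π : Equiv.Perm (Fin K), T.map π.toEmbedding = T' := by
  classical
  have e : {i // i ∈ T} ≃ {i // i ∈ T'} := Fintype.equivOfCardEq (by simpa using h)
  refine ⟨e.extendSubtype, Finset.eq_of_subset_of_card_le (fun i hi => ?_) (by simp [h])⟩
  obtain ⟨k, hk, rfl⟩ := Finset.mem_map.1 hi
  exact e.extendSubtype_mem k hk

lemma comp_mem_colorings {T : Finset (Fin K)} {c : Fin K → Fin g} (hc : c ∈ colorings g m T)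
    (π : Equiv.Perm (Fin K)) : c ∘ π ∈ colorings g m (T.map π.symm.toEmbedding) := by
  obtain ⟨h, l, rfl⟩ := mem_colorings.1 hc
  refine mem_colorings.2 ⟨fun l => ?_, l, colorClass_comp c π l⟩
  rw [colorClass_comp, Finset.card_map, h]

/-- A permutation of the indices that carries `T` to `T'` acts injectively on partitions. Hence the
normalising constant of the query law is the same for all admissible `(W, S)`. -/
lemma card_colorings_le {T T' : Finset (Fin K)} (h : T.card = T'.card) :
    (colorings g m T).card ≤ (colorings g m T').card := by
  obtain ⟨π, rfl⟩ := exists_perm_map_eq h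
  exact Finset.card_le_card_of_injOn (fun c => c ∘ π.symm)
    (fun c hc => by simpa using comp_mem_colorings hc π.symm)
    (fun c _ c' _ hcc => π.symm.surjective.injective_comp_right hcc)

lemma card_colorings_eq {T T' : Finset (Fin K)} (h : T.card = T'.card) :
    (colorings g m T).card = (colorings g m T').card :=
  (card_colorings_le h).antisymm (card_colorings_le h.symm)

lemma colorings_nonempty [NeZero g] (hK : K = g * m) {T : Finset (Fin K)} (hT : T.card = m) :
    (colorings g m T).Nonempty := by
  subst hK
  let c : Fin (g * m) → Fin g := fun i => (finProdFinEquiv.symm i).1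
  have hc : ∀ l, (colorClass c l).card = m := fun l => by
    have : colorClass c l = Finset.univ.image fun i : Fin m => finProdFinEquiv (l, i) := by
      ext i
      obtain ⟨⟨a, b⟩, rfl⟩ := finProdFinEquiv.surjective i
      simp only [mem_colorClass, c, Equiv.symm_apply_apply, Finset.mem_image, Finset.mem_univ,
        true_and, EmbeddingLike.apply_eq_iff_eq, Prod.mk.injEq, exists_and_left, exists_eq',
        and_true, eq_comm]
    rw [this, Finset.card_image_of_injective _ fun i i' h => by simpa using h, Finset.card_univ,
      Fintype.card_fin]
  rw [← Finset.card_pos, card_colorings_eq (T' := colorClass c 0) (hT.trans (hc 0).symm),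
    Finset.card_pos]
  exact ⟨c, mem_colorings.2 ⟨hc, 0, rfl⟩⟩

/-- For a given `W`, a partition into classes of size `M + 1` determines the set `S` for which the
class of `W` is `{W} ∪ S`. -/
lemma card_filter_mem_colorings (M : ℕ) (W : Fin K) (c : Fin K → Fin g) :
    (Finset.univ.filter fun S : Finset (Fin K) =>
      (W ∉ S ∧ S.card = M) ∧ c ∈ colorings g (M + 1) (insert W S)).card =
      if ∀ l, (colorClass c l).card = M + 1 then 1 else 0 := by
  split_ifs with hc
  · rw [Finset.card_eq_one]
    refine ⟨(colorClass c (c W)).erase W, ?_⟩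
    have hW : W ∈ colorClass c (c W) := mem_colorClass.2 rfl
    ext S
    simp only [Finset.mem_filter, Finset.mem_univ, true_and, Finset.mem_singleton]
    constructor
    · rintro ⟨⟨hWS, -⟩, h⟩
      rw [colorClass_of_mem_colorings h (Finset.mem_insert_self W S), Finset.erase_insert hWS]
    · rintro rfl
      refine ⟨⟨Finset.notMem_erase _ _, ?_⟩, ?_⟩
      · rw [Finset.card_erase_of_mem hW, hc, Nat.add_sub_cancel]
      · rw [Finset.insert_erase hW]
        exact mem_colorings.2 ⟨hc, c W, rfl⟩
  · rw [Finset.card_eq_zero, Finset.filter_eq_empty_iff]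
    rintro S - ⟨-, h⟩
    exact hc (mem_colorings.1 h).1

end Colorings

/-! ### The random-partition scheme: decodability and privacy. -/

section ColorScheme

variable {N K g : ℕ}

/-- A query: a partition of `[K]` into `g` labelled classes, and one symbol index per class. -/
abbrev ColorQuery (N K g : ℕ) : Type := (Fin K → Fin g) × (Fin g → ZMod N)

/-- The query to server `j`: the symbol index of the class of `W` is shifted by `j`. -/
def serverQuery (W : Fin K) (s : ColorQuery N K g) (j : Fin N) : ColorQuery N K g :=
  (s.1, s.2 + Pi.single (s.1 W) (j.val : ZMod N))

/-- For fixed `W` and `j` the shift is a bijection of queries, so it preserves the uniform law of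
the indices. -/
lemma serverQuery_eq_iff {W : Fin K} {s r : ColorQuery N K g} {j : Fin N} :
    serverQuery W s j = r ↔ s = (r.1, r.2 - Pi.single (r.1 W) (j.val : ZMod N)) := by
  obtain ⟨c, q⟩ := s
  obtain ⟨c', q'⟩ := r
  simp only [serverQuery, Prod.mk.injEq]
  constructor
  · rintro ⟨rfl, rfl⟩
    simp
  · rintro ⟨rfl, rfl⟩
    simp

/-- The law of the queries for the demand `W` and the side information index set `S`: a uniformly
random partition into classes of size `m` that has `{W} ∪ S` as a class, with independent uniformly
random symbol indices. -/
def queryLaw [NeZero N] [NeZero g] (m : ℕ) (W : Fin K) (S : Finset (Fin K)) :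
    PMF (Fin N → ColorQuery N K g) :=
  if h : (colorings g m (insert W S) ×ˢ (Finset.univ : Finset (Fin g → ZMod N))).Nonempty then
    (PMF.uniformOfFinset _ h).map (serverQuery W)
  -- A dummy value, never reached for admissible `(W, S)`, by `queryLaw_nonempty`.
  else PMF.pure fun _ => (fun _ => 0, 0)

lemma jointLaw_map_apply {β : Type} [Fintype β] (σ : Scheme N K)
    (p : PMF (Fin K × Finset (Fin K))) (Z : Database K σ.t × (Fin N → σ.Query) → β) (W : Fin K)
    (z : β) :
    (σ.jointLaw p).map (fun ω => (ω.1.1, Z ω.2)) (W, z) =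
      ∑ S, p (W, S) * (σ.law W S).map Z z := by
  classical
  have h1 : (σ.jointLaw p).map (fun ω => (ω.1.1, Z ω.2)) =
      p.bind fun ws => ((σ.law ws.1 ws.2).map Z).map fun z => (ws.1, z) := by
    unfold Scheme.jointLaw
    rw [PMF.map_bind]
    simp only [PMF.map_comp]
    rfl
  rw [h1, PMF.bind_apply, tsum_fintype, Fintype.sum_prod_type, Finset.sum_eq_single W]
  · refine Finset.sum_congr rfl fun S _ => ?_
    rw [pmf_map_apply_eq_sum]
    simp
  · intro W' _ hW
    refine Finset.sum_eq_zero fun S _ => ?_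
    rw [pmf_map_apply_eq_sum]
    simp [hW]
  · simp

variable [NeZero N] [NeZero g] {M : ℕ}

lemma queryLaw_nonempty (hK : K = g * (M + 1)) {W : Fin K} {S : Finset (Fin K)} (hW : W ∉ S)
    (hS : S.card = M) : (colorings g (M + 1) (insert W S) ×ˢ
      (Finset.univ : Finset (Fin g → ZMod N))).Nonempty :=
  Finset.Nonempty.product
    (colorings_nonempty hK (by rw [Finset.card_insert_of_notMem hW, hS])) Finset.univ_nonempty

lemma mem_support_queryLaw (hK : K = g * (M + 1)) {W : Fin K} {S : Finset (Fin K)} (hW : W ∉ S)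
    (hS : S.card = M) {Q : Fin N → ColorQuery N K g} :
    Q ∈ (queryLaw (M + 1) W S).support ↔
      ∃ s : ColorQuery N K g, s.1 ∈ colorings g (M + 1) (insert W S) ∧ serverQuery W s = Q := by
  rw [queryLaw, dif_pos (queryLaw_nonempty hK hW hS), PMF.mem_support_map_iff]
  simp only [PMF.mem_support_uniformOfFinset_iff, Finset.mem_product, Finset.mem_univ, and_true]

/-- The query to each server is uniform over the partitions that have `{W} ∪ S` as a class and over
all symbol indices. -/
lemma queryLaw_map_apply (hK : K = g * (M + 1)) {W : Fin K} {S : Finset (Fin K)} (hW : W ∉ S)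
    (hS : S.card = M) (j : Fin N) (r : ColorQuery N K g) :
    (queryLaw (M + 1) W S).map (fun Q => Q j) r =
      if r.1 ∈ colorings g (M + 1) (insert W S) then
        (((colorings g (M + 1) (insert W S)).card * N ^ g : ℕ) : ENNReal)⁻¹ else 0 := by
  classical
  rw [queryLaw, dif_pos (queryLaw_nonempty hK hW hS), PMF.map_comp, pmf_map_apply_eq_sum]
  simp only [Function.comp_apply, serverQuery_eq_iff, Finset.sum_ite_eq', Finset.mem_univ, if_true,
    PMF.uniformOfFinset_apply, Finset.mem_product, and_true, Finset.card_product, Finset.card_univ,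
    Fintype.card_pi, ZMod.card, Finset.prod_const, Fintype.card_fin]

/-- The scheme in which the servers receive the queries of `queryLaw` and answer with the query and
the value of `f`. -/
abbrev colorScheme (N K : ℕ) {g : ℕ} [NeZero N] [NeZero g] (m : ℕ) {t : ℕ} (ht : 0 < t) {A : Type}
    [Fintype A] (f : ColorQuery N K g → Database K t → A) : Scheme N K where
  t := t
  t_pos := ht
  Query := ColorQuery N K g
  Answer := ColorQuery N K g × A
  query W S _ := queryLaw m W S
  answer _ r X := (r, f r X)

variable {t : ℕ} (ht : 0 < t) {A : Type} [Fintype A] (f : ColorQuery N K g → Database K t → A)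

lemma mem_support_law {m : ℕ} {W : Fin K} {S : Finset (Fin K)}
    {ω : Database K t × (Fin N → ColorQuery N K g)} :
    ω ∈ ((colorScheme N K m ht f).law W S).support ↔ ω.2 ∈ (queryLaw m W S).support := by
  obtain ⟨X, Q⟩ := ω
  change (X, Q) ∈ ((PMF.uniformOfFintype (Database K t)).bind fun X =>
    (queryLaw m W S).map fun Q => (X, Q)).support ↔ _
  rw [PMF.mem_support_bind_iff]
  simp only [PMF.mem_support_uniformOfFintype, true_and, PMF.mem_support_map_iff]
  constructor
  · rintro ⟨X', Q', h, he⟩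
    cases he
    exact h
  · intro h
    exact ⟨X, Q, h, rfl⟩

lemma law_map_query {m : ℕ} (W : Fin K) (S : Finset (Fin K)) (j : Fin N) :
    ((colorScheme N K m ht f).law W S).map (fun ω => ω.2 j) =
      (queryLaw m W S).map (fun Q : Fin N → ColorQuery N K g => Q j) := by
  unfold Scheme.law
  rw [PMF.map_bind]
  simp only [PMF.map_comp]
  exact PMF.bind_const (PMF.uniformOfFintype (Database K t))
    ((queryLaw m W S).map fun Q : Fin N → ColorQuery N K g => Q j)

/-- Decodability in terms of the payload `f`: the payloads of the answers and the side information
determine the demanded message. -/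
def PayloadDecodable (f : ColorQuery N K g → Database K t → A) : Prop :=
  ∀ (W : Fin K) (S : Finset (Fin K)), W ∉ S →
    ∀ s : ColorQuery N K g, colorClass s.1 (s.1 W) = insert W S → ∀ X X' : Database K t,
    (∀ j, f (serverQuery W s j) X = f (serverQuery W s j) X') → (∀ i ∈ S, X i = X' i) →
    X W = X' W

lemma colorScheme_decodable (hK : K = g * (M + 1)) (hf : PayloadDecodable f) :
    (colorScheme N K (M + 1) ht f).Decodable M := by
  intro W S hW hS
  refine condEntropy_eq_zero_of_determined _ _ _ ?_
  rintro ⟨X, Q⟩ hω ⟨X', Q'⟩ - hZ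
  obtain ⟨hA, hX⟩ := Prod.mk.inj hZ
  have hA' : ∀ j, (Q j, f (Q j) X) = (Q' j, f (Q' j) X') := fun j => congrFun hA j
  have hQ : Q = Q' := funext fun j => (Prod.mk.inj (hA' j)).1
  subst hQ
  obtain ⟨s, hs, rfl⟩ := (mem_support_queryLaw hK hW hS).1 ((mem_support_law ht f).1 hω)
  exact hf W S hW s (colorClass_of_mem_colorings hs (Finset.mem_insert_self W S)) X X'
    (fun j => (Prod.mk.inj (hA' j)).2) fun i hi => congrFun hX ⟨i, hi⟩

/-- The queries ignore the value of `X_S`, so they are independent of the database. The view of a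
server therefore depends on `(W, S)` only through the law of its query. -/
lemma law_map_view_apply {m : ℕ} (W : Fin K) (S : Finset (Fin K)) (j : Fin N)
    (r : ColorQuery N K g) (a : ColorQuery N K g × A) (x : Database K t) :
    ((colorScheme N K m ht f).law W S).map
        (fun ω => (ω.2 j, (colorScheme N K m ht f).answerVar j ω, ω.1)) (r, a, x) =
      (queryLaw m W S).map (fun Q : Fin N → ColorQuery N K g => Q j) r *
        open Classical in if (r, f r x) = a then
          PMF.uniformOfFintype (Database K t) x else 0 := by
  classical
  have h1 : ((colorScheme N K m ht f).law W S).map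
      (fun ω => (ω.2 j, (colorScheme N K m ht f).answerVar j ω, ω.1)) =
      (PMF.uniformOfFintype (Database K t)).bind fun X =>
        ((queryLaw m W S).map (fun Q : Fin N → ColorQuery N K g => Q j)).map
          fun r => (r, (r, f r X), X) := by
    unfold Scheme.law
    rw [PMF.map_bind]
    simp only [PMF.map_comp]
    rfl
  refine (congrFun (congrArg DFunLike.coe h1) (r, a, x)).trans ?_
  rw [PMF.bind_apply, tsum_fintype, Finset.sum_eq_single x, pmf_map_apply_eq_sum,
    Finset.sum_eq_single r]
  · by_cases h : (r, f r x) = a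
    · simp [h, mul_comm]
    · simp [h]
  · intro r' _ hr
    simp [hr]
  · simp
  · intro x' _ hx
    rw [pmf_map_apply_eq_sum]
    simp [hx]
  · simp

/-- The core of privacy: for each `W`, a partition into classes of size `M + 1` arises from exactly
one `S`, and always with the same weight. The reference set `T` serves to write that weight without
`W`. -/
lemma sum_uniformLaw_mul_queryLaw (hK : K = g * (M + 1)) (hM : M < K) {T : Finset (Fin K)}
    (hT : T.card = M + 1) (W : Fin K) (j : Fin N) (r : ColorQuery N K g) :
    ∑ S, uniformLaw K M hM (W, S) *
        (queryLaw (M + 1) W S).map (fun Q : Fin N → ColorQuery N K g => Q j) r =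
      (if ∀ l, (colorClass r.1 l).card = M + 1 then 1 else 0) *
        ((((K - M) * K.choose M : ℕ) : ENNReal)⁻¹ *
          (((colorings g (M + 1) T).card * N ^ g : ℕ) : ENNReal)⁻¹) := by
  have hterm : ∀ S, uniformLaw K M hM (W, S) *
        (queryLaw (M + 1) W S).map (fun Q : Fin N → ColorQuery N K g => Q j) r =
      if (W ∉ S ∧ S.card = M) ∧ r.1 ∈ colorings g (M + 1) (insert W S) then
        ((((K - M) * K.choose M : ℕ) : ENNReal)⁻¹ *
          (((colorings g (M + 1) T).card * N ^ g : ℕ) : ENNReal)⁻¹) else 0 := by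
    intro S
    rw [uniformLaw, PMF.ofFintype_apply]
    by_cases hS : W ∉ S ∧ S.card = M
    · have hc : (insert W S).card = T.card := by
        rw [Finset.card_insert_of_notMem hS.1, hS.2, hT]
      rw [if_pos hS, queryLaw_map_apply hK hS.1 hS.2, card_colorings_eq hc]
      simp only [hS, true_and, mul_ite, mul_zero, not_false_eq_true]
    · rw [if_neg hS, zero_mul, if_neg fun h => hS h.1]
  rw [Finset.sum_congr rfl fun S _ => hterm S, ← Finset.sum_filter, Finset.sum_const,
    card_filter_mem_colorings, nsmul_eq_mul]
  norm_cast

lemma colorScheme_wPrivate (hK : K = g * (M + 1)) (hM : M < K) :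
    (colorScheme N K (M + 1) ht f).WPrivate (uniformLaw K M hM) := by
  classical
  intro j
  obtain ⟨T, -, hT⟩ := Finset.exists_subset_card_eq
    (s := (Finset.univ : Finset (Fin K))) (n := M + 1) (by simpa using hM)
  have key : ∀ (W : Fin K) (r : ColorQuery N K g) (a : ColorQuery N K g × A) (x : Database K t),
      prob ((colorScheme N K (M + 1) ht f).jointLaw (uniformLaw K M hM))
        (fun ω => (ω.1.1, (ω.2.2 j, (colorScheme N K (M + 1) ht f).answerVar j ω.2, ω.2.1)))
        (W, (r, a, x)) =
      ((if ∀ l, (colorClass r.1 l).card = M + 1 then 1 else 0) *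
        ((((K - M) * K.choose M : ℕ) : ENNReal)⁻¹ *
          (((colorings g (M + 1) T).card * N ^ g : ℕ) : ENNReal)⁻¹) *
        if (r, f r x) = a then PMF.uniformOfFintype (Database K t) x else 0).toReal := by
    intro W r a x
    unfold prob
    congr 1
    refine (jointLaw_map_apply (colorScheme N K (M + 1) ht f) (uniformLaw K M hM)
      (fun ω => (ω.2 j, (colorScheme N K (M + 1) ht f).answerVar j ω, ω.1)) W (r, a, x)).trans ?_
    rw [← sum_uniformLaw_mul_queryLaw hK hM hT W j r, Finset.sum_mul]
    refine Finset.sum_congr rfl fun S _ => ?_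
    rw [mul_assoc]
    congr 1
    exact (law_map_view_apply ht f W S j r a x).trans (by congr!)
  refine mutualInfo_eq_zero_of_const _ _ _ ?_
  rintro W W' ⟨r, a, x⟩
  exact (key W r a x).trans (key W' r a x).symm

end ColorScheme

/-! ### Download cost and the limit of long messages. -/

section Rate

variable {N K g M : ℕ} [NeZero N] [NeZero g] {t : ℕ} (ht : 0 < t) {A : Type} [Fintype A]
  (f : ColorQuery N K g → Database K t → A)

/-- The number of bits that suffices to name a query. -/
def queryBits (N K g : ℕ) [NeZero N] : ℝ := Real.logb 2 (Fintype.card (ColorQuery N K g))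

lemma sum_prob_query_mul (hK : K = g * (M + 1)) {W : Fin K} {S : Finset (Fin K)} (hW : W ∉ S)
    (hS : S.card = M) (j : Fin N) (h : (Fin g → ZMod N) → ℝ) :
    ∑ r, prob ((colorScheme N K (M + 1) ht f).law W S) (fun ω => ω.2 j) r * h r.2 =
      (∑ q, h q) / N ^ g := by
  have hp : ∀ r, prob ((colorScheme N K (M + 1) ht f).law W S) (fun ω => ω.2 j) r =
      if r.1 ∈ colorings g (M + 1) (insert W S) then
        ((colorings g (M + 1) (insert W S)).card * (N : ℝ) ^ g)⁻¹ else 0 := by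
    intro r
    unfold prob
    rw [law_map_query, queryLaw_map_apply hK hW hS]
    split_ifs <;> simp
  have hn : ((colorings g (M + 1) (insert W S)).card : ℝ) ≠ 0 :=
    Nat.cast_ne_zero.2 (Finset.card_pos.2 (colorings_nonempty hK
      (by rw [Finset.card_insert_of_notMem hW, hS]))).ne'
  simp_rw [hp]
  rw [Fintype.sum_prod_type]
  simp only [ite_mul, zero_mul]
  rw [Finset.sum_comm]
  simp only [← Finset.sum_filter, Finset.filter_mem_eq_inter, Finset.univ_inter, Finset.sum_const,
    nsmul_eq_mul]
  rw [Finset.sum_div]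
  refine Finset.sum_congr rfl fun q _ => ?_
  field_simp

/-- An answer can be described by the name of the query, at a fixed cost of `queryBits`, followed by
`len` bits for the payload. These lengths satisfy Kraft's inequality, and their mean is computed
from the uniform law of the indices. -/
lemma entropy_answerVar_le [DecidableEq A] (hK : K = g * (M + 1)) {W : Fin K}
    {S : Finset (Fin K)} (hW : W ∉ S) (hS : S.card = M) (j : Fin N)
    (len : (Fin g → ZMod N) → ℕ)
    (hlen : ∀ r, (Finset.univ.image (f r)).card ≤ 2 ^ len r.2) :
    entropy ((colorScheme N K (M + 1) ht f).law W S)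
        ((colorScheme N K (M + 1) ht f).answerVar j) ≤
      queryBits N K g + (∑ q, (len q : ℝ)) / N ^ g := by
  classical
  have hQ : (0 : ℝ) < Fintype.card (ColorQuery N K g) := by exact_mod_cast Fintype.card_pos
  have hpow : ∀ n : ℕ, (2 : ℝ) ^ (-(queryBits N K g + n)) =
      (2 ^ n)⁻¹ * (Fintype.card (ColorQuery N K g) : ℝ)⁻¹ := by
    intro n
    rw [Real.rpow_neg two_pos.le, Real.rpow_add two_pos, queryBits,
      Real.rpow_logb two_pos (by norm_num) hQ, Real.rpow_natCast, mul_inv, mul_comm]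
  refine (entropy_le_of_kraft _ _
    (Finset.univ.filter fun a : ColorQuery N K g × A => a.2 ∈ Finset.univ.image (f a.1))
    (fun a => queryBits N K g + len a.1.2) ?_ ?_).trans_eq ?_
  · rintro ⟨X, Q⟩ -
    exact Finset.mem_filter.2 ⟨Finset.mem_univ _, Finset.mem_image_of_mem _ (Finset.mem_univ X)⟩
  · rw [Finset.sum_filter, Fintype.sum_prod_type]
    have : ∀ r : ColorQuery N K g, (∑ y : A, if y ∈ Finset.univ.image (f r) then
        (2 : ℝ) ^ (-(queryBits N K g + len r.2)) else 0) ≤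
        (Fintype.card (ColorQuery N K g) : ℝ)⁻¹ := by
      intro r
      rw [← Finset.sum_filter, Finset.filter_mem_eq_inter, Finset.univ_inter, Finset.sum_const,
        nsmul_eq_mul, hpow, ← mul_assoc]
      refine mul_le_of_le_one_left (by positivity) ?_
      rw [← div_eq_mul_inv, div_le_one (by positivity)]
      exact_mod_cast hlen r
    refine (Finset.sum_le_sum fun r _ => this r).trans_eq ?_
    rw [Finset.sum_const, nsmul_eq_mul, Finset.card_univ, mul_inv_cancel₀ hQ.ne']
  · have h := sum_prob_comp ((colorScheme N K (M + 1) ht f).law W S)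
      ((colorScheme N K (M + 1) ht f).answerVar j) (Prod.fst : ColorQuery N K g × A → _)
      (fun r => queryBits N K g + len r.2)
    refine h.trans ?_
    have h2 := sum_prob_query_mul ht f hK hW hS j fun q => queryBits N K g + len q
    refine h2.trans ?_
    rw [Finset.sum_add_distrib, add_div]
    congr 1
    have hN : (N : ℝ) ^ g ≠ 0 := pow_ne_zero _ (Nat.cast_ne_zero.2 (NeZero.ne N))
    simp [ZMod.card, mul_div_cancel_left₀ _ hN]

variable {f}

/-- Needed because division by zero gives `0`: a vanishing download would make `rateAt` zero rather
than infinite. -/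
lemma sum_entropy_answerVar_pos (hK : K = g * (M + 1)) (hf : PayloadDecodable f) {W : Fin K}
    {S : Finset (Fin K)} (hW : W ∉ S) (hS : S.card = M) :
    0 < ∑ j, entropy ((colorScheme N K (M + 1) ht f).law W S)
        ((colorScheme N K (M + 1) ht f).answerVar j) := by
  obtain ⟨c, hc⟩ := colorings_nonempty (T := insert W S) hK
    (by rw [Finset.card_insert_of_notMem hW, hS])
  -- These two databases differ only in message `W`, so decodability forces some answer to tell them
  -- apart.
  have hne : ¬ ∀ j, f (serverQuery W (c, 0) j) 0 =
      f (serverQuery W (c, 0) j) (Function.update 0 W fun _ => 1) := by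
    intro h
    have h1 := hf W S hW (c, 0)
      (colorClass_of_mem_colorings hc (Finset.mem_insert_self W S)) _ _ h fun i hi => by
        rw [Function.update_of_ne (ne_of_mem_of_not_mem hi hW)]
    simpa using congrFun h1 ⟨0, ht⟩
  push Not at hne
  obtain ⟨j, hj⟩ := hne
  refine Finset.sum_pos' (fun j _ => entropy_nonneg _ _) ⟨j, Finset.mem_univ _, ?_⟩
  have hQ : serverQuery W (c, 0) ∈ (queryLaw (N := N) (g := g) (M + 1) W S).support :=
    (mem_support_queryLaw hK hW hS).2 ⟨(c, 0), hc, rfl⟩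
  exact entropy_pos_of_ne _ _ (ω := (0, serverQuery W (c, 0)))
    (ω' := (Function.update 0 W fun _ => 1, serverQuery W (c, 0)))
    ((mem_support_law ht f).2 hQ) ((mem_support_law ht f).2 hQ)
    fun h => hj (Prod.mk.inj h).2

lemma le_rate_colorScheme [DecidableEq A] (hK : K = g * (M + 1)) (hf : PayloadDecodable f)
    (len : (Fin g → ZMod N) → ℕ)
    (hlen : ∀ r, (Finset.univ.image (f r)).card ≤ 2 ^ len r.2) {D : ℝ}
    (hD : N * ((∑ q, (len q : ℝ)) / N ^ g) ≤ D) :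
    ((t / (N * queryBits N K g + D) : ℝ) : EReal) ≤ (colorScheme N K (M + 1) ht f).rate M := by
  refine le_iInf fun W => le_iInf fun S => le_iInf fun h => ?_
  rw [EReal.coe_le_coe_iff]
  refine div_le_div_of_nonneg_left (Nat.cast_nonneg t)
    (sum_entropy_answerVar_pos ht hK hf h.1 h.2) ?_
  refine (Finset.sum_le_sum fun j _ =>
    entropy_answerVar_le ht f hK h.1 h.2 j len hlen).trans ?_
  rw [Finset.sum_const, Finset.card_univ, Fintype.card_fin, nsmul_eq_mul, mul_add]
  linarith

/-- Scaling the message length by `L` scales the payload cost but not the cost of naming queries.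
The rates `b / (N * queryBits / L + d)` are thus all below the capacity, and so is their limit. -/
lemma le_capacityW_of_payload (hK : K = g * (M + 1)) (hM : M < K) {b : ℕ} (hb : 0 < b) {d : ℝ}
    (hd : 0 < d)
    (h : ∀ L : ℕ, 0 < L → ∃ (A : Type) (_ : Fintype A) (_ : DecidableEq A)
      (f : ColorQuery N K g → Database K (L * b) → A) (len : (Fin g → ZMod N) → ℕ),
      PayloadDecodable f ∧ (∀ r, (Finset.univ.image (f r)).card ≤ 2 ^ len r.2) ∧
      N * ((∑ q, (len q : ℝ)) / N ^ g) ≤ L * d) :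
    ((b / d : ℝ) : EReal) ≤ capacityW N K M (uniformLaw K M hM) := by
  have hle : ∀ n : ℕ, ((b / (N * queryBits N K g / (n + 1 : ℕ) + d) : ℝ) : EReal) ≤
      capacityW N K M (uniformLaw K M hM) := by
    intro n
    obtain ⟨A, _, _, f, len, hf, hlen, hD⟩ := h (n + 1) n.succ_pos
    have ht : 0 < (n + 1) * b := Nat.mul_pos n.succ_pos hb
    refine le_trans ?_ (le_iSup₂_of_le (colorScheme N K (M + 1) ht f)
      ⟨colorScheme_decodable ht f hK hf, colorScheme_wPrivate ht f hK hM⟩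
      (le_rate_colorScheme ht hK hf len hlen hD))
    rw [EReal.coe_le_coe_iff]
    have hn : ((n + 1 : ℕ) : ℝ) ≠ 0 := by positivity
    refine le_of_eq ?_
    rw [Nat.cast_mul, ← mul_div_mul_left _ _ hn, mul_add, mul_div_cancel₀ _ hn]
  have h0 := (tendsto_const_div_atTop_nhds_zero_nat (N * queryBits N K g)).comp
    (Filter.tendsto_add_atTop_nat 1)
  have h1 := h0.add_const d
  rw [zero_add] at h1
  exact le_of_tendsto' ((continuous_coe_real_ereal.tendsto _).comp
    (tendsto_const_nhds.div h1 hd.ne')) hle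

end Rate

/-! ### The two payloads and their decoding. -/

section Payloads

variable {N K g : ℕ}

/-- The sums of the messages over the classes of the partition. -/
def classSums {t : ℕ} (r : ColorQuery N K g) (X : Database K t) : Fin g → Message t :=
  fun l => ∑ i ∈ colorClass r.1 l, X i

lemma payloadDecodable_classSums [NeZero N] {t : ℕ} :
    PayloadDecodable (classSums : ColorQuery N K g → Database K t → _) := by
  intro W S hW s hs X X' h hX
  have h1 := congrFun (h 0) (s.1 W)
  simp only [classSums, serverQuery] at h1
  rw [hs, Finset.sum_insert hW, Finset.sum_insert hW, Finset.sum_congr rfl hX] at h1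
  exact add_right_cancel h1

/-- The symbol of a message at index `a`: the symbols at nonzero indices are blocks of `L` bits of
the message, the symbol at index `0` is zero. -/
def messageSymbol {L : ℕ} [NeZero N] (x : Message (L * (N - 1))) (a : ZMod N) : Fin L → ZMod 2 :=
  fun l => if h : a = 0 then 0 else
    -- A nonzero index has representative in `1, …, N - 1`; subtracting one numbers the `N - 1`
    -- blocks from zero.
    x (finProdFinEquiv (l, ⟨a.val - 1, by
      have := ZMod.val_lt a
      have := ZMod.val_pos.2 h
      omega⟩))

lemma messageSymbol_zero {L : ℕ} [NeZero N] (x : Message (L * (N - 1))) :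
    messageSymbol x 0 = 0 := by
  funext l
  simp [messageSymbol]

lemma messageSymbol_injective {L : ℕ} [NeZero N] {x x' : Message (L * (N - 1))}
    (h : ∀ a, messageSymbol x a = messageSymbol x' a) : x = x' := by
  funext i
  obtain ⟨⟨l, k⟩, rfl⟩ := finProdFinEquiv.surjective i
  have hk : k.val + 1 < N := by have := k.isLt; omega
  have hv : ((k.val + 1 : ℕ) : ZMod N).val = k.val + 1 := ZMod.val_cast_of_lt hk
  have h0 : ((k.val + 1 : ℕ) : ZMod N) ≠ 0 := fun h0 => by
    rw [h0, ZMod.val_zero] at hv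
    omega
  have := congrFun (h (k.val + 1 : ℕ)) l
  simpa only [messageSymbol, h0, dite_false, hv, Nat.add_sub_cancel] using this

/-- The sum of the symbols of the messages, the index being that of the class of the message. -/
def symbolSum {L : ℕ} [NeZero N] (r : ColorQuery N K g) (X : Database K (L * (N - 1))) :
    Fin L → ZMod 2 :=
  ∑ i, messageSymbol (X i) (r.2 (r.1 i))

/-- The other classes contribute the same interference to every answer, while the index of the class
of `W` runs through all of `ZMod N`. -/
lemma payloadDecodable_symbolSum {L : ℕ} [NeZero N] :
    PayloadDecodable (symbolSum : ColorQuery N K g → Database K (L * (N - 1)) → _) := by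
  intro W S hW s hs X X' h hX
  have hj : ∀ a : ZMod N, ∃ j : Fin N, s.2 (s.1 W) + (j.val : ZMod N) = a := fun a =>
    ⟨⟨(a - s.2 (s.1 W)).val, ZMod.val_lt _⟩, by simp⟩
  have hsum : ∀ (Y : Database K (L * (N - 1))) (j : Fin N), symbolSum (serverQuery W s j) Y =
      messageSymbol (Y W) (s.2 (s.1 W) + (j.val : ZMod N)) +
        ∑ i ∈ S, messageSymbol (Y i) (s.2 (s.1 W) + (j.val : ZMod N)) +
      ∑ i ∈ (insert W S)ᶜ, messageSymbol (Y i) (s.2 (s.1 i)) := by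
    intro Y j
    rw [symbolSum, ← Finset.sum_add_sum_compl (insert W S),
      ← Finset.sum_insert (f := fun i => messageSymbol (Y i) (s.2 (s.1 W) + (j.val : ZMod N))) hW]
    congr 1 <;> refine Finset.sum_congr rfl fun i hi => ?_
    · rw [← hs, mem_colorClass] at hi
      simp [serverQuery, hi]
    · rw [Finset.mem_compl, ← hs, mem_colorClass] at hi
      simp [serverQuery, hi]
  have hS : ∀ a, ∑ i ∈ S, messageSymbol (X i) a = ∑ i ∈ S, messageSymbol (X' i) a := fun a =>
    Finset.sum_congr rfl fun i hi => by rw [hX i hi]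
  have hI : ∑ i ∈ (insert W S)ᶜ, messageSymbol (X i) (s.2 (s.1 i)) =
      ∑ i ∈ (insert W S)ᶜ, messageSymbol (X' i) (s.2 (s.1 i)) := by
    -- At the server where the class of `W` has index `0`, that class contributes nothing and the
    -- interference is exposed.
    obtain ⟨j, hj⟩ := hj 0
    have h1 := h j
    rw [hsum, hsum, hj, hS, messageSymbol_zero, messageSymbol_zero] at h1
    exact add_left_cancel h1
  refine messageSymbol_injective fun a => ?_
  obtain ⟨j, rfl⟩ := hj a
  have h1 := h j
  rw [hsum, hsum, hS, hI] at h1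
  exact add_right_cancel (add_right_cancel h1)

lemma card_image_symbolSum_le {L : ℕ} [NeZero N] (r : ColorQuery N K g) :
    (Finset.univ.image (symbolSum r : Database K (L * (N - 1)) → Fin L → ZMod 2)).card ≤
      2 ^ (if r.2 = 0 then 0 else L) := by
  split_ifs with hr
  · rw [pow_zero, Finset.card_le_one]
    have h0 : ∀ X : Database K (L * (N - 1)), symbolSum r X = 0 := fun X =>
      Finset.sum_eq_zero fun i _ => by rw [hr, Pi.zero_apply, messageSymbol_zero]
    simp [h0]
  · exact (Finset.card_le_univ _).trans_eq (by simp [ZMod.card])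

lemma sum_symbolSum_length [NeZero N] (L : ℕ) :
    ∑ q : Fin g → ZMod N, (((if q = 0 then 0 else L : ℕ)) : ℝ) = (N ^ g - 1) * L := by
  classical
  have : ∀ q : Fin g → ZMod N, (((if q = 0 then 0 else L : ℕ)) : ℝ) =
      L - if q = 0 then (L : ℝ) else 0 := fun q => by split_ifs <;> simp
  rw [Finset.sum_congr rfl fun q _ => this q, Finset.sum_sub_distrib, Finset.sum_ite_eq']
  simp [ZMod.card]
  ring

end Payloads

end PIRSI

end

theorem theorem3 (N K M : ℕ) (hN : 1 ≤ N) (hM : M < K) (hdvd : (M + 1) ∣ K) :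
    (((∑ i ∈ Finset.range (K / (M + 1)), 1 / (N : ℝ) ^ i)⁻¹ : ℝ) : EReal) ≤
      PIRSI.capacityW N K M (PIRSI.uniformLaw K M hM) := by
  have hK : K = K / (M + 1) * (M + 1) := (Nat.div_mul_cancel hdvd).symm
  have hg : 0 < K / (M + 1) := Nat.div_pos hM M.succ_pos
  set g := K / (M + 1)
  have : NeZero N := ⟨by omega⟩
  have : NeZero g := ⟨hg.ne'⟩
  rcases hN.eq_or_lt with rfl | hN2
  -- With one server there would be `N - 1 = 0` blocks; downloading all `g` class sums gives the
  -- rate `1 / g`.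
  · have h := PIRSI.le_capacityW_of_payload (N := 1) hK hM (b := 1) (d := g) one_pos
      (by exact_mod_cast hg) fun L _ => ⟨_, inferInstance, inferInstance, PIRSI.classSums,
        fun _ => g * L, PIRSI.payloadDecodable_classSums,
        fun r => (Finset.card_le_univ _).trans_eq (by simp [ZMod.card, ← pow_mul, mul_comm]),
        by simp [mul_comm]⟩
    simpa using h
  · have hN1 : (1 : ℝ) < N := by exact_mod_cast hN2
    have hpow : (1 : ℝ) < N ^ g := one_lt_pow₀ hN1 hg.ne'
    -- `d` is the expected payload per unit of `L`: each of the `N` servers sends `L` bits unless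
    -- all its indices vanish.
    have h := PIRSI.le_capacityW_of_payload (N := N) hK hM (b := N - 1)
      (d := N * ((N ^ g - 1) / N ^ g)) (by omega)
      (mul_pos (by linarith) (div_pos (by linarith) (by linarith)))
      fun L _ => ⟨_, inferInstance, inferInstance, PIRSI.symbolSum,
        fun q => if q = 0 then 0 else L, PIRSI.payloadDecodable_symbolSum,
        PIRSI.card_image_symbolSum_le, by
          rw [PIRSI.sum_symbolSum_length]
          exact le_of_eq (by ring)⟩
    convert h using 2
    have hNne : (N : ℝ) ≠ 0 := by positivity
    have hN1' : (N : ℝ) - 1 ≠ 0 := by linarith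
    have hsum : ∑ i ∈ Finset.range g, 1 / (N : ℝ) ^ i =
        N * ((N ^ g - 1) / N ^ g) / (N - 1) := by
      have hne : (1 / N : ℝ) ≠ 1 := by
        rw [Ne, div_eq_one_iff_eq hNne]
        exact hN1.ne
      simp_rw [← one_div_pow]
      rw [geom_sum_eq hne, one_div_pow]
      have : (1 : ℝ) - N ≠ 0 := by linarith
      field_simp
      ring
    rw [hsum, inv_div, Nat.cast_sub hN, Nat.cast_one]
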